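/- Let $f(z)=z+z^2$ on $\mathbb{C}$, and let $\mathcal{A}$ be its parabolic basin at $0$ for the attraction vector $-1$, i.e. the set of all $z\in\mathbb{C}$ such that $f^k(z)\to 0$ and $f^k(z)\sim -1/k$ as $k\to\infty$. For $z\in\mathcal{A}$ and $\xi\in\mathbb{C}$ put $$F_{\mathcal{A}}(z,\xi)=\inf\{\lambda>0:\ \text{there is a holomorphic } g:\{|\zeta|<1\}\to\mathcal{A}\ \text{with}\ g(0)=z,\ \lambda g'(0)=\xi\},$$ and let the Kobayashi distance $d_{\mathcal{A}}(z,w)$ be the infimum of $\int_0^1F_{\mathcal{A}}(\gamma(t),\gamma'(t))\,dt$ over all piecewise $C^1$ curves $\gamma:[0,1]\to\mathcal{A}$ with $\gamma(0)=z$ and $\gamma(1)=w$ (with $\inf\emptyset=\infty$). Then $-\tfrac12\in\mathcal{A}$, and for every $C>0$ there is a point $z_0\in\mathcal{A}$ such that $$d_{\mathcal{A}}(z_0,\tilde q)\ge C\quad\text{for every}\quad \tilde q\in Q:=\bigcup_{l,k\ge 0} f^{-l}\bigl(f^k(-\tfrac12)\bigr).$$ -/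

import Mathlib

open Set Filter Topology MeasureTheory Asymptotics
open scoped ENNReal

noncomputable section

/-- The parabolic basin `𝒜(0, v)` at the fixed point `0` of a map
`f z = z + a z ^ (m + 1) + ⋯` (with `m ≥ 1`, `a ≠ 0`), for an attraction vector `v`
(that is, `m a v ^ m = -1`): the set of all `z` whose orbit converges to `0` and is
asymptotic to `v / k ^ (1 / m)` as `k → ∞`. For `f z = z + z ^ 2` one has `m = 1`, `a = 1`,
and `v = -1` is the only attraction vector. -/
def parabolicBasin (f : ℂ → ℂ) (m : ℕ) (v : ℂ) : Set ℂ :=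
  {z | Tendsto (fun k : ℕ => f^[k] z) atTop (𝓝 0) ∧
    (fun k : ℕ => f^[k] z) ~[atTop] fun k : ℕ => v / (((k : ℝ) ^ (1 / (m : ℝ)) : ℝ) : ℂ)}

/-- The grand orbit `⋃ f⁻ˡ(fᵏ(q))`, over all integers `l, k ≥ 0`. -/
def grandOrbit (f : ℂ → ℂ) (q : ℂ) : Set ℂ :=
  ⋃ (l : ℕ) (k : ℕ), f^[l] ⁻¹' {f^[k] q}

/-- The infinitesimal Kobayashi metric `F_Ω(z, ξ)`: the infimum of all `c > 0` for which there
is a holomorphic map `g` from the unit disc to `Ω` with `g 0 = z` and `c g'(0) = ξ`. -/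
def kobayashiMetric (Ω : Set ℂ) (z ξ : ℂ) : ℝ≥0∞ :=
  sInf {x | ∃ c : ℝ, 0 < c ∧ x = ENNReal.ofReal c ∧
    ∃ g : ℂ → ℂ, DifferentiableOn ℂ g (Metric.ball 0 1) ∧ MapsTo g (Metric.ball 0 1) Ω ∧
      g 0 = z ∧ (c : ℂ) * deriv g 0 = ξ}

/-- `γ` restricts to a piecewise continuously differentiable curve on `[0, 1]`. -/
def IsPiecewiseSmooth (γ : ℝ → ℂ) : Prop :=
  ContinuousOn γ (Icc 0 1) ∧
    ∃ (n : ℕ) (t : ℕ → ℝ), Monotone t ∧ t 0 = 0 ∧ t n = 1 ∧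
      ∀ i < n, ContDiffOn ℝ 1 γ (Icc (t i) (t (i + 1)))

/-- The Kobayashi length `∫₀¹ F_Ω(γ(t), γ'(t)) dt` of a piecewise smooth curve. (The finitely
many break points, where `deriv` may be meaningless, form a null set.) -/
def kobayashiLength (Ω : Set ℂ) (γ : ℝ → ℂ) : ℝ≥0∞ :=
  ∫⁻ t in Icc (0 : ℝ) 1, kobayashiMetric Ω (γ t) (deriv γ t)

/-- The Kobayashi distance in the open set `Ω`: the infimum of the Kobayashi lengths of the
piecewise smooth curves in `Ω` from `z` to `w` (as usual `∞` if there is no such curve). -/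
def kobayashiDist (Ω : Set ℂ) (z w : ℂ) : ℝ≥0∞ :=
  sInf {L | ∃ γ : ℝ → ℂ, IsPiecewiseSmooth γ ∧ MapsTo γ (Icc 0 1) Ω ∧ γ 0 = z ∧ γ 1 = w ∧
    L = kobayashiLength Ω γ}

end

/-! The grand orbit of the real point `-1/2` contains only points whose orbit eventually enters the
real axis, so it suffices to find a large Kobayashi ball of points whose orbits avoid that axis. In
the coordinate `u = -1/z - 1` the map is nearly a unit translation, and orbits starting far from the
axis, not too far left, pass around it (`iterate_parabolicShift_sq_sub_one`).

The basin misses `[0, ∞)`, so `s = √(-1/z)` maps it into the right half plane, where `u = s² - 1`.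
By Schwarz–Pick, a path of length at most `C` changes `log |s|` and `log Re s` by at most `2C`
(`abs_log_sub_le_of_kobayashiLength_le`). From a centre with `Re s` large and `|s|` far larger,
every point so reached keeps `Re s ≥ 4` and `|Im s| ≥ 1`, which is exactly the region of avoidance.
-/

/-! ### Lower bounds for the Kobayashi length -/

/-- Infinitesimal **Schwarz–Pick** at the origin for maps of the disc into the right half plane. -/
theorem norm_deriv_zero_le_two_mul_re {h : ℂ → ℂ} (hd : DifferentiableOn ℂ h (Metric.ball 0 1))
    (hpos : ∀ ζ ∈ Metric.ball (0 : ℂ) 1, 0 < (h ζ).re) :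
    ‖deriv h 0‖ ≤ 2 * (h 0).re := by
  have h0mem : (0 : ℂ) ∈ Metric.ball (0 : ℂ) 1 := by simp
  have h0 := hpos 0 h0mem
  set p : ℂ := h 0 with hp
  set p' : ℂ := (starRingEnd ℂ) p with hp'
  have hne : ∀ ζ ∈ Metric.ball (0 : ℂ) 1, h ζ + p' ≠ 0 := by
    intro ζ hζ H
    have := congrArg Complex.re H
    simp [hp'] at this
    linarith [hpos ζ hζ]
  -- The Cayley quotient sends `p` to `0` and the half plane to the disc; its derivative at `0` is
  -- `h'(0) / (2 Re p)`.
  have hdiff : DifferentiableOn ℂ (fun ζ => (h ζ - p) / (h ζ + p')) (Metric.ball 0 1) :=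
    (hd.sub_const p).div (hd.add_const p') hne
  have hmaps : MapsTo (fun ζ => (h ζ - p) / (h ζ + p')) (Metric.ball 0 1)
      (Metric.closedBall ((fun ζ => (h ζ - p) / (h ζ + p')) 0) 1) := by
    intro ζ hζ
    have hz := hpos ζ hζ
    simp only [← hp, sub_self, zero_div, mem_closedBall_zero_iff, norm_div]
    rw [div_le_one (norm_pos_iff.2 (hne ζ hζ)), ← sq_le_sq₀ (norm_nonneg _) (norm_nonneg _),
      Complex.sq_norm, Complex.sq_norm, Complex.normSq_apply, Complex.normSq_apply]
    simp [hp']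
    nlinarith [mul_pos hz h0]
  have key := Complex.norm_deriv_le_one_of_mapsTo_ball hdiff hmaps one_pos
  have hat : HasDerivAt h (deriv h 0) 0 :=
    (hd.differentiableAt (Metric.isOpen_ball.mem_nhds h0mem)).hasDerivAt
  have hder := (hat.sub_const p).div (hat.add_const p') (hne 0 h0mem)
  have hsum : p + p' = ((2 * p.re : ℝ) : ℂ) := by
    rw [hp', Complex.add_conj]
  have hval : deriv (fun ζ => (h ζ - p) / (h ζ + p')) 0 = deriv h 0 / (p + p') := by
    refine hder.deriv.trans ?_
    have := hne 0 h0mem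
    rw [← hp] at this ⊢
    field_simp
    ring
  rw [hval, hsum, norm_div, Complex.norm_real, Real.norm_of_nonneg (by positivity),
    div_le_one (by positivity)] at key
  exact key

/-- A real function on the right half plane that is `1`-Lipschitz for the metric `|ds| / Re s`
pulls back, under a holomorphic map to the half plane, to a function whose differential is at most
twice the Kobayashi metric. -/
theorem enorm_fderiv_comp_le {Ω U : Set ℂ} (hU : IsOpen U) (hΩ : Ω ⊆ U) {ψ : ℂ → ℂ}
    (hψ : DifferentiableOn ℂ ψ U) (hpos : ∀ z ∈ U, 0 < (ψ z).re) {ρ : ℂ → ℝ}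
    (hρ : ∀ s : ℂ, 0 < s.re → DifferentiableAt ℝ ρ s)
    (hρ' : ∀ s : ℂ, 0 < s.re → ∀ η : ℂ, |fderiv ℝ ρ s η| ≤ ‖η‖ / s.re)
    {z : ℂ} (hz : z ∈ Ω) (ξ : ℂ) :
    ‖fderiv ℝ (fun z => ρ (ψ z)) z ξ‖ₑ ≤ 2 * kobayashiMetric Ω z ξ := by
  have h2 : (2 : ℝ≥0∞) ≠ 0 := by norm_num
  have h2' : (2 : ℝ≥0∞) ≠ ∞ := by norm_num
  rw [← ENNReal.div_le_iff' h2 h2']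
  refine le_sInf ?_
  rintro _ ⟨c, hc, rfl, g, hg, hgm, hg0, hgξ⟩
  rw [ENNReal.div_le_iff' h2 h2']
  have h0mem : (0 : ℂ) ∈ Metric.ball (0 : ℂ) 1 := by simp
  have hzU := hU.mem_nhds (hΩ hz)
  have hψz : HasDerivAt ψ (deriv ψ z) z := (hψ.differentiableAt hzU).hasDerivAt
  have hgz : HasDerivAt g (deriv g 0) 0 :=
    (hg.differentiableAt (Metric.isOpen_ball.mem_nhds h0mem)).hasDerivAt
  have hcomp : HasDerivAt (fun ζ => ψ (g ζ)) (deriv ψ z * deriv g 0) 0 := by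
    rw [← hg0] at hψz ⊢
    exact hψz.comp 0 hgz
  have hpick := norm_deriv_zero_le_two_mul_re (h := fun ζ => ψ (g ζ))
    (hψ.comp hg fun ζ hζ => hΩ (hgm hζ)) fun ζ hζ => hpos _ (hΩ (hgm hζ))
  rw [hcomp.deriv] at hpick
  simp only [hg0] at hpick
  have hp := hpos z (hΩ hz)
  have hf : fderiv ℝ (fun z => ρ (ψ z)) z ξ = fderiv ℝ ρ (ψ z) (deriv ψ z * ξ) := by
    have := (hρ _ hp).hasFDerivAt.comp z (hψz.hasFDerivAt.restrictScalars ℝ)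
    rw [show (fun z => ρ (ψ z)) = ρ ∘ ψ from rfl, this.fderiv]
    simp [mul_comm]
  have hle : |fderiv ℝ (fun z => ρ (ψ z)) z ξ| ≤ 2 * c := by
    rw [hf]
    refine (hρ' _ hp _).trans ?_
    rw [div_le_iff₀ hp, ← hgξ, mul_left_comm, norm_mul, Complex.norm_real,
      Real.norm_of_nonneg hc.le]
    nlinarith
  rw [Real.enorm_eq_ofReal_abs, show (2 : ℝ≥0∞) = ENNReal.ofReal 2 by simp,
    ← ENNReal.ofReal_mul (by norm_num)]
  exact ENNReal.ofReal_le_ofReal hle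

/-- A function whose differential is bounded by a multiple of the Kobayashi metric varies along a
curve by at most this multiple of its Kobayashi length. -/
theorem enorm_sub_le_mul_kobayashiLength {Ω U : Set ℂ} (hU : IsOpen U) (hΩ : Ω ⊆ U) {r : ℂ → ℝ}
    (hr : ContDiffOn ℝ 1 r U) {c : ℝ≥0∞} (hc : c ≠ ∞)
    (hbound : ∀ z ∈ Ω, ∀ ξ, ‖fderiv ℝ r z ξ‖ₑ ≤ c * kobayashiMetric Ω z ξ)
    {γ : ℝ → ℂ} (hγ : IsPiecewiseSmooth γ) (hm : MapsTo γ (Icc 0 1) Ω) :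
    ‖r (γ 1) - r (γ 0)‖ₑ ≤ c * kobayashiLength Ω γ := by
  obtain ⟨-, n, t, ht, ht0, htn, hsm⟩ := hγ
  let F : ℝ → ℝ≥0∞ := fun s => c * kobayashiMetric Ω (γ s) (deriv γ s)
  have hnonneg : ∀ i, 0 ≤ t i := fun i => ht0 ▸ ht (Nat.zero_le i)
  have hle1 : ∀ i ≤ n, t i ≤ 1 := fun i hi => htn ▸ ht hi
  have hpiece : ∀ i < n, ‖r (γ (t (i + 1))) - r (γ (t i))‖ₑ ≤
      ∫⁻ s in Ioc (t i) (t (i + 1)), F s := by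
    intro i hi
    have hsub : Icc (t i) (t (i + 1)) ⊆ Icc 0 1 :=
      Icc_subset_Icc (hnonneg i) (hle1 _ hi)
    have hcd : ContDiffOn ℝ 1 (fun s => r (γ s)) (Icc (t i) (t (i + 1))) :=
      hr.comp (hsm i hi) fun s hs => hΩ (hm (hsub hs))
    refine (enorm_sub_le_lintegral_deriv_of_contDiffOn_Icc hcd (ht (Nat.le_succ i))).trans ?_
    -- On the open interval `deriv γ` is a genuine two-sided derivative.
    rw [setLIntegral_congr Ioo_ae_eq_Icc.symm, setLIntegral_congr Ioo_ae_eq_Ioc.symm]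
    refine setLIntegral_mono' measurableSet_Ioo fun s hs => ?_
    have hsI := Ioo_subset_Icc_self hs
    have hγs : DifferentiableAt ℝ γ s :=
      ((hsm i hi).differentiableOn one_ne_zero).differentiableAt (Icc_mem_nhds hs.1 hs.2)
    have hmem := hm (hsub hsI)
    have hrs : DifferentiableAt ℝ r (γ s) :=
      (hr.differentiableOn one_ne_zero).differentiableAt (hU.mem_nhds (hΩ hmem))
    have hd : deriv (fun s => r (γ s)) s = fderiv ℝ r (γ s) (deriv γ s) :=
      (hrs.hasFDerivAt.comp_hasDerivAt s hγs.hasDerivAt).deriv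
    rw [hd]
    exact hbound _ hmem _
  have hind : ∀ k ≤ n, ‖r (γ (t k)) - r (γ 0)‖ₑ ≤ ∫⁻ s in Ioc 0 (t k), F s := by
    intro k
    induction k with
    | zero => intro _; simp [ht0]
    | succ k ih =>
      intro hk
      have hadd : r (γ (t (k + 1))) - r (γ 0) =
          (r (γ (t k)) - r (γ 0)) + (r (γ (t (k + 1))) - r (γ (t k))) := by ring
      rw [hadd, ← Ioc_union_Ioc_eq_Ioc (hnonneg k) (ht (Nat.le_succ k)),
        lintegral_union measurableSet_Ioc (Ioc_disjoint_Ioc_of_le le_rfl)]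
      exact (enorm_add_le _ _).trans (add_le_add (ih (by omega)) (hpiece k (by omega)))
  have := hind n le_rfl
  rw [htn, setLIntegral_congr Ioc_ae_eq_Icc, lintegral_const_mul' _ _ hc] at this
  exact this

/-! ### Two Lipschitz functions on the right half plane -/

/-- The differential of `log |s|` on the right half plane. -/
theorem hasFDerivAt_log_norm {s : ℂ} (hs : 0 < s.re) :
    HasFDerivAt (fun s : ℂ => Real.log ‖s‖)
      (Complex.reCLM ∘L (ContinuousLinearMap.toSpanSingleton ℂ s⁻¹).restrictScalars ℝ) s := by
  have h := (Complex.hasDerivAt_log (Or.inl hs)).hasFDerivAt.restrictScalars ℝ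
  refine (Complex.reCLM.hasFDerivAt.comp s h).congr_of_eventuallyEq (.of_forall fun w => ?_)
  simp [Complex.log_re]

theorem contDiffOn_log_norm : ContDiffOn ℝ 1 (fun s : ℂ => Real.log ‖s‖) {s | 0 < s.re} := by
  refine ContDiffOn.log (contDiffOn_id.norm ℝ ?_) ?_
  all_goals
    rintro s hs
    have : s ≠ 0 := by rintro rfl; simp at hs
    simpa using this

theorem contDiffOn_log_re : ContDiffOn ℝ 1 (fun s : ℂ => Real.log s.re) {s | 0 < s.re} :=
  Complex.reCLM.contDiff.contDiffOn.log fun _ hs => ne_of_gt hs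

theorem abs_fderiv_log_norm_le (s : ℂ) (hs : 0 < s.re) (η : ℂ) :
    |fderiv ℝ (fun s : ℂ => Real.log ‖s‖) s η| ≤ ‖η‖ / s.re := by
  rw [(hasFDerivAt_log_norm hs).fderiv]
  have : |(η * s⁻¹).re| ≤ ‖η‖ / s.re := by
    refine (Complex.abs_re_le_norm _).trans ?_
    rw [norm_mul, norm_inv, ← div_eq_mul_inv]
    exact div_le_div_of_nonneg_left (norm_nonneg _) hs (Complex.re_le_norm s)
  simpa using this

theorem abs_fderiv_log_re_le (s : ℂ) (hs : 0 < s.re) (η : ℂ) :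
    |fderiv ℝ (fun s : ℂ => Real.log s.re) s η| ≤ ‖η‖ / s.re := by
  have h : HasFDerivAt (fun s : ℂ => Real.log s.re) (s.re⁻¹ • Complex.reCLM) s :=
    (Complex.reCLM.hasFDerivAt (x := s)).log hs.ne'
  rw [h.fderiv]
  have : |s.re⁻¹ * η.re| ≤ ‖η‖ / s.re := by
    rw [abs_mul, abs_inv, abs_of_pos hs, inv_mul_eq_div]
    exact div_le_div_of_nonneg_right (Complex.abs_re_le_norm η) hs.le
  simpa using this

/-- Along a curve in `Ω`, the logarithms of modulus and real part of a holomorphic map to the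
right half plane vary by at most twice the Kobayashi length. -/
theorem abs_log_sub_le_of_kobayashiLength_le {Ω U : Set ℂ} (hU : IsOpen U) (hΩ : Ω ⊆ U)
    {ψ : ℂ → ℂ} (hψ : DifferentiableOn ℂ ψ U) (hpos : ∀ z ∈ U, 0 < (ψ z).re)
    {γ : ℝ → ℂ} (hγ : IsPiecewiseSmooth γ) (hm : MapsTo γ (Icc 0 1) Ω) {C : ℝ} (hC : 0 ≤ C)
    (hlen : kobayashiLength Ω γ ≤ ENNReal.ofReal C) :
    |Real.log ‖ψ (γ 1)‖ - Real.log ‖ψ (γ 0)‖| ≤ 2 * C ∧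
      |Real.log (ψ (γ 1)).re - Real.log (ψ (γ 0)).re| ≤ 2 * C := by
  have hψc : ContDiffOn ℝ 1 ψ U := (hψ.contDiffOn hU).restrict_scalars ℝ
  have hopen : IsOpen {s : ℂ | 0 < s.re} := isOpen_lt continuous_const Complex.continuous_re
  have main : ∀ ρ : ℂ → ℝ, ContDiffOn ℝ 1 ρ {s | 0 < s.re} →
      (∀ s : ℂ, 0 < s.re → ∀ η : ℂ, |fderiv ℝ ρ s η| ≤ ‖η‖ / s.re) →
      |ρ (ψ (γ 1)) - ρ (ψ (γ 0))| ≤ 2 * C := by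
    intro ρ hρ hρ'
    have hd : ∀ s : ℂ, 0 < s.re → DifferentiableAt ℝ ρ s := fun s hs =>
      (hρ.differentiableOn one_ne_zero).differentiableAt (hopen.mem_nhds hs)
    have h := enorm_sub_le_mul_kobayashiLength hU hΩ (hρ.comp hψc hpos) (c := 2) (by norm_num)
      (fun z hz ξ => enorm_fderiv_comp_le hU hΩ hψ hpos hd hρ' hz ξ) hγ hm
    have h' := h.trans (mul_le_mul_right hlen 2)
    rw [Real.enorm_eq_ofReal_abs, show (2 : ℝ≥0∞) = ENNReal.ofReal 2 by simp,
      ← ENNReal.ofReal_mul (by norm_num), ENNReal.ofReal_le_ofReal_iff (by positivity)] at h'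
    exact h'
  exact ⟨main _ contDiffOn_log_norm abs_fderiv_log_norm_le,
    main _ contDiffOn_log_re abs_fderiv_log_re_le⟩

/-! ### Dynamics in the parabolic coordinate -/

/-- The map `z ↦ z + z ^ 2` in the coordinate `u = -1 / z - 1`. -/
noncomputable def parabolicShift (u : ℂ) : ℂ := u + 1 + 1 / u

/-- The inverse `u ↦ -1 / (u + 1)` of the coordinate at the parabolic point. -/
noncomputable def ofParabolicCoord (u : ℂ) : ℂ := -1 / (u + 1)

theorem add_sq_ofParabolicCoord {u : ℂ} (hu : u ≠ 0) :
    ofParabolicCoord u + ofParabolicCoord u ^ 2 = ofParabolicCoord (parabolicShift u) := by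
  unfold ofParabolicCoord parabolicShift
  by_cases h : u + 1 = 0
  -- Here `u = -1` is fixed by the shift, and division by zero gives `ofParabolicCoord (-1) = 0`, a
  -- fixed point too.
  · obtain rfl : u = -1 := eq_neg_of_add_eq_zero_left h
    norm_num
  · have h2 : u + 1 + 1 / u + 1 = (u + 1) ^ 2 / u := by field_simp; ring
    rw [h2]
    field_simp
    ring

theorem iterate_ofParabolicCoord {u : ℂ} (hu : ∀ n, parabolicShift^[n] u ≠ 0) (n : ℕ) :
    (fun z : ℂ => z + z ^ 2)^[n] (ofParabolicCoord u) =
      ofParabolicCoord (parabolicShift^[n] u) := by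
  induction n with
  | zero => rfl
  | succ n ih =>
    rw [Function.iterate_succ_apply', Function.iterate_succ_apply', ih]
    exact add_sq_ofParabolicCoord (hu n)

theorem parabolicShift_re (u : ℂ) :
    (parabolicShift u).re = u.re + 1 + u.re / Complex.normSq u := by
  simp [parabolicShift, Complex.inv_re]

theorem parabolicShift_im (u : ℂ) :
    (parabolicShift u).im = u.im * (1 - 1 / Complex.normSq u) := by
  simp [parabolicShift, Complex.inv_im]
  ring

theorem add_one_le_parabolicShift_re {u : ℂ} (hu : 1 ≤ u.re) :
    u.re + 1 ≤ (parabolicShift u).re := by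
  rw [parabolicShift_re]
  have : 0 ≤ u.re / Complex.normSq u := div_nonneg (by linarith) (Complex.normSq_nonneg u)
  linarith

theorem le_iterate_parabolicShift_re {u : ℂ} (hu : 1 ≤ u.re) (n : ℕ) :
    (n : ℝ) + 1 ≤ (parabolicShift^[n] u).re := by
  induction n with
  | zero => simpa using hu
  | succ n ih =>
    rw [Function.iterate_succ_apply']
    have h0 : (0 : ℝ) ≤ n := n.cast_nonneg
    have := add_one_le_parabolicShift_re (u := parabolicShift^[n] u) (by linarith)
    push_cast
    linarith

theorem mem_parabolicBasin_iff {f : ℂ → ℂ} {z : ℂ} :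
    z ∈ parabolicBasin f 1 (-1) ↔ Tendsto (fun k : ℕ => f^[k] z) atTop (𝓝 0) ∧
      (fun k : ℕ => f^[k] z) ~[atTop] fun k : ℕ => (-1 : ℂ) / (k : ℂ) := by
  simp [parabolicBasin]

/-- If the orbit of `u` under the shift reaches the half plane `1 ≤ Re u`, then it is asymptotic
to `n`. -/
theorem tendsto_iterate_parabolicShift_div {u : ℂ} {N : ℕ}
    (hN : 1 ≤ (parabolicShift^[N] u).re) :
    Tendsto (fun n : ℕ => parabolicShift^[n] u / (n : ℂ)) atTop (𝓝 1) ∧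
      Tendsto (fun n : ℕ => ‖parabolicShift^[n] u‖) atTop atTop := by
  set v : ℕ → ℂ := fun n => parabolicShift^[n] u with hv
  have hnorm : Tendsto (fun n => ‖v n‖) atTop atTop := by
    rw [← tendsto_add_atTop_iff_nat N]
    refine tendsto_atTop_mono (fun n => ?_) tendsto_natCast_atTop_atTop
    have := le_iterate_parabolicShift_re hN n
    rw [← Function.iterate_add_apply] at this
    exact (by linarith : (n : ℝ) ≤ _).trans (Complex.re_le_norm (v (n + N)))
  have hinv : Tendsto (fun n => (v n)⁻¹) atTop (𝓝 0) :=
    tendsto_inv₀_cobounded.comp (tendsto_norm_atTop_iff_cobounded.1 hnorm)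
  have hdiff : Tendsto (fun n => v (n + 1) - v n) atTop (𝓝 1) := by
    have h1 : (fun n => v (n + 1) - v n) = fun n => 1 + (v n)⁻¹ := by
      funext n
      simp only [hv, Function.iterate_succ_apply']
      unfold parabolicShift
      ring
    rw [h1]
    simpa using hinv.const_add 1
  -- The increments `1 + 1 / v n` tend to `1`, hence so do their averages, which telescope.
  have hces := hdiff.cesaro_smul
  simp only [Finset.sum_range_sub] at hces
  have h0 : Tendsto (fun n : ℕ => v 0 / (n : ℂ)) atTop (𝓝 0) :=
    tendsto_const_div_atTop_nhds_zero_nat (v 0)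
  refine ⟨?_, hnorm⟩
  have := hces.add h0
  simp only [add_zero] at this
  refine this.congr fun n => ?_
  rw [Complex.real_smul]
  push_cast
  ring

theorem ofParabolicCoord_mem_parabolicBasin {u : ℂ} (hu : ∀ n, parabolicShift^[n] u ≠ 0) {N : ℕ}
    (hN : 1 ≤ (parabolicShift^[N] u).re) :
    ofParabolicCoord u ∈ parabolicBasin (fun z => z + z ^ 2) 1 (-1) := by
  rw [mem_parabolicBasin_iff]
  simp only [iterate_ofParabolicCoord hu]
  obtain ⟨h1, hnorm⟩ := tendsto_iterate_parabolicShift_div hN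
  have hinvn : Tendsto (fun n : ℕ => (1 : ℂ) / (n : ℂ)) atTop (𝓝 0) :=
    tendsto_const_div_atTop_nhds_zero_nat 1
  have hratio : Tendsto (fun n : ℕ => ((n : ℂ) / (parabolicShift^[n] u + 1))) atTop (𝓝 1) := by
    have h2 := (h1.add hinvn).inv₀ (by simp)
    simp only [add_zero, inv_one] at h2
    refine h2.congr fun n => ?_
    rw [← add_div, inv_div]
  have hequiv : (fun n => ofParabolicCoord (parabolicShift^[n] u)) ~[atTop]
      fun n : ℕ => (-1 : ℂ) / (n : ℂ) := by
    rw [isEquivalent_iff_tendsto_one]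
    · refine hratio.congr fun n => ?_
      simp only [Pi.div_apply, ofParabolicCoord]
      rw [div_div_div_eq, mul_comm (-1 : ℂ), mul_neg_one, mul_neg_one, neg_div_neg_eq]
    · filter_upwards [eventually_ne_atTop 0] with n hn
      simpa using hn
  refine ⟨?_, hequiv⟩
  have h3 : Tendsto (fun n : ℕ => (-1 : ℂ) / (n : ℂ)) atTop (𝓝 0) :=
    tendsto_const_div_atTop_nhds_zero_nat (-1)
  exact hequiv.symm.tendsto_nhds h3

/-- Orbits starting high above or below a shallow parabola never meet the real axis and reach the
half plane `1 ≤ Re u`. -/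
theorem iterate_parabolicShift_im_ne_zero {u : ℂ} {Y : ℝ} (hY : 4 ≤ Y) (him : Y ≤ |u.im|)
    (hre : -(Y ^ 2 / 16) ≤ u.re) :
    (∀ n, (parabolicShift^[n] u).im ≠ 0) ∧ ∃ N, 1 ≤ (parabolicShift^[N] u).re := by
  -- Until `Re ≥ 1`, each step gains at least `1/2` in `Re` and loses at most `2/Y` in `|Im|`. This
  -- lasts at most `2 + Y²/8` steps, so `|Im| ≥ Y/2` throughout since `Y ≥ 4`.
  have key : ∀ n : ℕ, (1 ≤ (parabolicShift^[n] u).re ∧ (parabolicShift^[n] u).im ≠ 0) ∨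
      ((parabolicShift^[n] u).re < 1 ∧ -(Y ^ 2 / 16) + n / 2 ≤ (parabolicShift^[n] u).re ∧
        Y - 2 * n / Y ≤ |(parabolicShift^[n] u).im|) := by
    intro n
    induction n with
    | zero =>
      rcases le_or_gt 1 u.re with h | h
      · refine Or.inl ⟨h, fun h0 => ?_⟩
        simp at h0
        rw [h0] at him
        simp at him
        linarith
      · exact Or.inr ⟨h, by simpa using hre, by simpa using him⟩
    | succ n ih =>
      rw [Function.iterate_succ_apply']
      set v := parabolicShift^[n] u
      have hsq : Complex.normSq v = v.re ^ 2 + v.im ^ 2 := by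
        rw [Complex.normSq_apply]; ring
      rcases ih with ⟨h1, h2⟩ | ⟨h1, h2, h3⟩
      · refine Or.inl ⟨by linarith [add_one_le_parabolicShift_re h1], ?_⟩
        rw [parabolicShift_im]
        -- Once `Re ≥ 1` and `Im ≠ 0`, the factor `1 - 1/|v|²` of `Im` is positive.
        have hgt : 1 < Complex.normSq v := by
          have := sq_pos_of_ne_zero h2
          nlinarith
        have : 1 / Complex.normSq v < 1 := by rw [div_lt_one (by linarith)]; exact hgt
        exact mul_ne_zero h2 (by linarith)
      · have hY0 : 0 < Y := by linarith
        have hn : (n : ℝ) ≤ 2 + Y ^ 2 / 8 := by linarith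
        have hhalf : Y / 2 ≤ |v.im| := by
          have : 2 * (n : ℝ) / Y ≤ Y / 2 := by
            rw [div_le_iff₀ hY0]
            nlinarith
          linarith
        have hpos : 0 < |v.im| := by linarith
        have himsq : |v.im| ^ 2 ≤ Complex.normSq v := by
          rw [sq_abs, hsq]; nlinarith [sq_nonneg v.re]
        have hNpos : 0 < Complex.normSq v := by nlinarith
        have hstep : |v.im| - 2 / Y ≤ |(parabolicShift v).im| := by
          have hinv : |v.im| * (1 / Complex.normSq v) ≤ 2 / Y := by
            rw [mul_one_div, div_le_div_iff₀ hNpos hY0]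
            nlinarith
          rw [parabolicShift_im, abs_mul]
          have := mul_le_mul_of_nonneg_left (le_abs_self (1 - 1 / Complex.normSq v)) hpos.le
          linarith
        have hre' : v.re + 1 / 2 ≤ (parabolicShift v).re := by
          rw [parabolicShift_re]
          have : -(1 / 2) ≤ v.re / Complex.normSq v := by
            rw [le_div_iff₀ hNpos]
            nlinarith [sq_nonneg (v.re + 1)]
          linarith
        have him' : Y - 2 * ((n + 1 : ℕ) : ℝ) / Y ≤ |(parabolicShift v).im| := by
          have : Y - 2 * ((n + 1 : ℕ) : ℝ) / Y = Y - 2 * n / Y - 2 / Y := by push_cast; ring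
          linarith
        rcases le_or_gt 1 (parabolicShift v).re with h | h
        · refine Or.inl ⟨h, fun h0 => ?_⟩
          rw [h0, abs_zero] at hstep
          have : 2 / Y ≤ 1 / 2 := by rw [div_le_div_iff₀ hY0 two_pos]; linarith
          linarith
        · refine Or.inr ⟨h, ?_, him'⟩
          push_cast
          linarith
  refine ⟨fun n h0 => ?_, ?_⟩
  · rcases key n with ⟨-, h⟩ | ⟨h1, h2, h3⟩
    · exact h h0
    · rw [h0, abs_zero, sub_nonpos, le_div_iff₀ (by linarith)] at h3
      nlinarith
  · obtain ⟨N, hN⟩ := exists_nat_gt (2 + Y ^ 2 / 8)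
    refine ⟨N, ?_⟩
    rcases key N with ⟨h, -⟩ | ⟨h1, h2, -⟩
    · exact h
    · linarith

/-! ### Avoiding the grand orbit and the half line -/

theorem ofParabolicCoord_im_ne_zero {u : ℂ} (hu : u.im ≠ 0) : (ofParabolicCoord u).im ≠ 0 := by
  have hne : u + 1 ≠ 0 := fun h => hu (by simpa using congrArg Complex.im h)
  have : (ofParabolicCoord u).im = u.im / Complex.normSq (u + 1) := by
    simp [ofParabolicCoord, neg_div]
  rw [this]
  exact div_ne_zero hu (Complex.normSq_pos.2 hne).ne'

theorem iterate_add_sq_im_eq_zero {x : ℂ} (hx : x.im = 0) (n : ℕ) :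
    ((fun z : ℂ => z + z ^ 2)^[n] x).im = 0 := by
  induction n with
  | zero => exact hx
  | succ n ih =>
    rw [Function.iterate_succ_apply']
    generalize (fun z : ℂ => z + z ^ 2)^[n] x = w at ih
    simp [pow_two, ih]

/-- A point whose orbit never meets the real axis is not in the grand orbit of a real point. -/
theorem ofParabolicCoord_notMem_grandOrbit {u x : ℂ} (hx : x.im = 0)
    (hu : ∀ n, (parabolicShift^[n] u).im ≠ 0) :
    ofParabolicCoord u ∉ grandOrbit (fun z => z + z ^ 2) x := by
  intro h
  simp only [grandOrbit, mem_iUnion, mem_preimage, mem_singleton_iff] at h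
  obtain ⟨l, k, h⟩ := h
  rw [iterate_ofParabolicCoord fun n h0 => hu n (by rw [h0]; rfl)] at h
  exact ofParabolicCoord_im_ne_zero (hu l) (h ▸ iterate_add_sq_im_eq_zero hx k)

/-- The basin misses the closed half line `[0, ∞)`. -/
theorem neg_mem_slitPlane_of_mem_parabolicBasin {z : ℂ}
    (hz : z ∈ parabolicBasin (fun z => z + z ^ 2) 1 (-1)) : -z ∈ Complex.slitPlane := by
  by_contra hns
  have hnn : ∀ n : ℕ, 0 ≤ ((fun z : ℂ => z + z ^ 2)^[n] z).re ∧
      ((fun z : ℂ => z + z ^ 2)^[n] z).im = 0 := by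
    intro n
    induction n with
    | zero =>
      simpa [Complex.mem_slitPlane_iff, not_or] using hns
    | succ n ih =>
      rw [Function.iterate_succ_apply']
      generalize (fun z : ℂ => z + z ^ 2)^[n] z = w at ih
      simp only [pow_two, Complex.add_re, Complex.mul_re, Complex.add_im, Complex.mul_im, ih.2]
      constructor
      · nlinarith [ih.1, mul_nonneg ih.1 ih.1]
      · ring
  have heq := (mem_parabolicBasin_iff.1 hz).2
  rw [isEquivalent_iff_tendsto_one] at heq
  · have hre := (Complex.continuous_re.tendsto _).comp heq
    rw [Complex.one_re] at hre
    -- Nonnegative real iterates have nonpositive ratio to `-1/n`, which cannot tend to `1`.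
    have hle : (1 : ℝ) ≤ 0 := by
      refine le_of_tendsto hre (.of_forall fun n => ?_)
      simp only [Function.comp_apply, Pi.div_apply]
      rw [div_div_eq_mul_div, div_neg, div_one, Complex.neg_re, Complex.mul_re]
      simp
      exact mul_nonneg (hnn n).1 n.cast_nonneg
    linarith
  · filter_upwards [eventually_ne_atTop 0] with n hn
    simpa using hn

/-! ### The square root coordinate -/

/-- The square root of `-1 / z` with positive real part. -/
noncomputable def sqrtCoord (z : ℂ) : ℂ := Complex.exp (-(Complex.log (-z) / 2))

theorem differentiableOn_sqrtCoord :
    DifferentiableOn ℂ sqrtCoord {z | -z ∈ Complex.slitPlane} := by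
  intro z hz
  exact (((differentiableAt_id.neg.clog hz).div_const 2).neg.cexp).differentiableWithinAt

theorem sqrtCoord_re_pos {z : ℂ} (hz : -z ∈ Complex.slitPlane) : 0 < (sqrtCoord z).re := by
  rw [sqrtCoord, Complex.exp_re]
  refine mul_pos (Real.exp_pos _) (Real.cos_pos_of_mem_Ioo ?_)
  have h1 := Complex.neg_pi_lt_arg (-z)
  have h2 := (Complex.arg_le_pi (-z)).lt_of_ne (Complex.mem_slitPlane_iff_arg.1 hz).1
  have h3 : (-(Complex.log (-z) / 2)).im = -(Complex.arg (-z) / 2) := by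
    rw [Complex.neg_im, Complex.div_ofNat_im, Complex.log_im]
  rw [h3]
  constructor <;> linarith

theorem sqrtCoord_sq {z : ℂ} (hz : z ≠ 0) : sqrtCoord z ^ 2 = -1 / z := by
  rw [sqrtCoord, ← Complex.exp_nat_mul]
  have : ((2 : ℕ) : ℂ) * -(Complex.log (-z) / 2) = -Complex.log (-z) := by push_cast; ring
  rw [this, Complex.exp_neg, Complex.exp_log (neg_ne_zero.2 hz), ← neg_inv, neg_div, one_div]

theorem ofParabolicCoord_sqrtCoord {z : ℂ} (hz : z ≠ 0) :
    ofParabolicCoord (sqrtCoord z ^ 2 - 1) = z := by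
  rw [sqrtCoord_sq hz, ofParabolicCoord]
  field_simp
  ring

theorem sqrtCoord_ofParabolicCoord {s : ℂ} (hs : 0 < s.re)
    (h : -ofParabolicCoord (s ^ 2 - 1) ∈ Complex.slitPlane) :
    sqrtCoord (ofParabolicCoord (s ^ 2 - 1)) = s := by
  have hs0 : s ≠ 0 := by rintro rfl; simp at hs
  have hne : ofParabolicCoord (s ^ 2 - 1) ≠ 0 := by
    simp [ofParabolicCoord, hs0]
  have hsq : sqrtCoord (ofParabolicCoord (s ^ 2 - 1)) ^ 2 = s ^ 2 := by
    rw [sqrtCoord_sq hne, ofParabolicCoord]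
    field_simp
    ring
  rcases sq_eq_sq_iff_eq_or_eq_neg.1 hsq with h' | h'
  · exact h'
  · have := sqrtCoord_re_pos h
    rw [h', Complex.neg_re] at this
    linarith

/-- With `Y = |Im (s² - 1)| = 2 Re s |Im s|`, one has `Y²/16 ≥ 4 (Im s)²`, which dominates the
negative part of `Re (s² - 1)`. -/
theorem iterate_parabolicShift_sq_sub_one {s : ℂ} (hre : 4 ≤ s.re) (him : 1 ≤ |s.im|) :
    (∀ n, (parabolicShift^[n] (s ^ 2 - 1)).im ≠ 0) ∧
      ∃ N, 1 ≤ (parabolicShift^[N] (s ^ 2 - 1)).re := by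
  have h1 : (s ^ 2 - 1).im = 2 * s.re * s.im := by
    simp [pow_two]; ring
  have h2 : (s ^ 2 - 1).re = s.re ^ 2 - s.im ^ 2 - 1 := by
    simp [pow_two]
  have h3 : |(s ^ 2 - 1).im| = 2 * s.re * |s.im| := by
    rw [h1, abs_mul, abs_of_nonneg (by linarith)]
  have h4 : 1 ≤ s.im ^ 2 := by rw [← sq_abs]; nlinarith
  refine iterate_parabolicShift_im_ne_zero (Y := 2 * s.re * |s.im|) (by nlinarith) h3.ge ?_
  rw [h2, mul_pow, sq_abs]
  nlinarith [mul_le_mul hre hre (by norm_num) (by linarith)]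

theorem mem_Icc_of_abs_log_sub_le {x y C : ℝ} (hx : 0 < x) (hy : 0 < y)
    (h : |Real.log y - Real.log x| ≤ C) : x ≤ Real.exp C * y ∧ y ≤ Real.exp C * x := by
  have := abs_le.1 h
  constructor
  · rw [← Real.log_le_log_iff hx (by positivity), Real.log_mul (Real.exp_ne_zero _) hy.ne',
      Real.log_exp]
    linarith
  · rw [← Real.log_le_log_iff hy (by positivity), Real.log_mul (Real.exp_ne_zero _) hx.ne',
      Real.log_exp]
    linarith

/-! ### The base point and the distance estimate -/

theorem neg_half_mem_parabolicBasin :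
    (-1 / 2 : ℂ) ∈ parabolicBasin (fun z => z + z ^ 2) 1 (-1) := by
  have h : (-1 / 2 : ℂ) = ofParabolicCoord 1 := by norm_num [ofParabolicCoord]
  rw [h]
  refine ofParabolicCoord_mem_parabolicBasin (N := 0) (fun n h0 => ?_) (by simp)
  have := le_iterate_parabolicShift_re (u := 1) (by simp) n
  rw [h0, Complex.zero_re] at this
  have : (0 : ℝ) ≤ n := n.cast_nonneg
  linarith

theorem theoremA :
    (-1 / 2 : ℂ) ∈ parabolicBasin (fun z => z + z ^ 2) 1 (-1) ∧
    ∀ C : ℝ, 0 < C →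
      ∃ z₀ ∈ parabolicBasin (fun z => z + z ^ 2) 1 (-1),
        ∀ q ∈ grandOrbit (fun z => z + z ^ 2) (-1 / 2),
          ENNReal.ofReal C ≤ kobayashiDist (parabolicBasin (fun z => z + z ^ 2) 1 (-1)) z₀ q := by
  refine ⟨neg_half_mem_parabolicBasin, fun C hC => ?_⟩
  set K : ℝ := Real.exp (2 * C) with hK
  have hK1 : 1 ≤ K := Real.one_le_exp (by linarith)
  -- Losing a factor `K` leaves `4 ≤ Re s ≤ 4K²` and `|s| ≥ 1 + 4K²`, hence `|Im s| ≥ 1`.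
  let s₀ : ℂ := ⟨4 * K, K * (1 + 4 * K ^ 2)⟩
  have hs₀re : s₀.re = 4 * K := rfl
  have hs₀im : s₀.im = K * (1 + 4 * K ^ 2) := rfl
  have hs₀pos : 0 < s₀.re := by rw [hs₀re]; linarith
  obtain ⟨him₀, N₀, hN₀⟩ := iterate_parabolicShift_sq_sub_one (s := s₀) (by rw [hs₀re]; linarith)
    (by rw [hs₀im]; exact le_trans (by nlinarith [sq_nonneg K]) (le_abs_self _))
  have hmem₀ := ofParabolicCoord_mem_parabolicBasin
    (fun n h0 => him₀ n (by rw [h0, Complex.zero_im])) hN₀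
  refine ⟨_, hmem₀, fun q hq => le_sInf ?_⟩
  rintro _ ⟨γ, hγ, hm, hγ0, hγ1, rfl⟩
  by_contra! hlt
  have hopen : IsOpen {z : ℂ | -z ∈ Complex.slitPlane} :=
    Complex.isOpen_slitPlane.preimage continuous_neg
  have hqmem := neg_mem_slitPlane_of_mem_parabolicBasin
    (hγ1 ▸ hm (right_mem_Icc.2 zero_le_one))
  obtain ⟨hnorm, hre⟩ := abs_log_sub_le_of_kobayashiLength_le hopen
    (fun _ => neg_mem_slitPlane_of_mem_parabolicBasin) differentiableOn_sqrtCoord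
    (fun _ => sqrtCoord_re_pos) hγ hm hC.le hlt.le
  rw [hγ0, hγ1, sqrtCoord_ofParabolicCoord hs₀pos
    (neg_mem_slitPlane_of_mem_parabolicBasin hmem₀)] at hnorm hre
  have hspos := sqrtCoord_re_pos hqmem
  have hq0 : q ≠ 0 := by rintro rfl; simp at hqmem
  rw [← ofParabolicCoord_sqrtCoord hq0] at hq
  set s := sqrtCoord q
  obtain ⟨hre₁, hre₂⟩ := mem_Icc_of_abs_log_sub_le hs₀pos hspos hre
  obtain ⟨hnorm₁, -⟩ := mem_Icc_of_abs_log_sub_le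
    (hs₀pos.trans_le (Complex.re_le_norm _)) (hspos.trans_le (Complex.re_le_norm _)) hnorm
  rw [← hK, hs₀re] at hre₁ hre₂
  have hK0 : 0 < K := by linarith
  have hs4 : 4 ≤ s.re := by nlinarith
  have hb : 1 + 4 * K ^ 2 ≤ ‖s‖ := by
    have := (le_abs_self _).trans ((Complex.abs_im_le_norm s₀).trans hnorm₁)
    rw [hs₀im] at this
    exact le_of_mul_le_mul_left this hK0
  have hsim : 1 ≤ |s.im| := by
    have := Complex.norm_le_abs_re_add_abs_im s
    rw [abs_of_pos hspos] at this
    nlinarith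
  exact ofParabolicCoord_notMem_grandOrbit (by simp)
    (iterate_parabolicShift_sq_sub_one hs4 hsim).1 hq
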